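/- Let $R$ be a commutative ring with $1$. Let $M$ be a countably infinite $\omega$-categorical first-order structure in a countable language which is a Ramsey structure, i.e. a countable ultrahomogeneous structure whose age (the class of finite structures embeddable in $M$; by $\omega$-categoricity finitely generated substructures of $M$ are finite) is a class of rigid structures with the Ramsey property: for all $A \subseteq B$ in the age and all $k \in \mathbb{N}$ there is $C \supseteq B$ in the age such that for every $k$-colouring of the substructures of $C$ isomorphic to $A$ there is a substructure $B' \cong B$ of $C$ on whose copies of $A$ the colouring is constant. Let $G = \mathrm{Aut}(M)$ and let $W$ be a sort in $M^{eq}$, i.e. $W = D/E$ for a $\emptyset$-definable $D \subseteq M^n$ and a $\emptyset$-definable equivalence relation $E$ on $D$. Let $RW$ be the free $R$-module with basis $W$, regarded as an $RG$-module by letting $G$ permute the basis. Let $x, v_1, \ldots, v_r \in RW$, let $S \subseteq W$ be the (finite) support of $x$, and let $G_{(S)}$ be the pointwise stabiliser of $S$ in $G$. Then: 1. $G_{(S)}$ has finitely many orbits $W_1, \ldots, W_l$ on $W$, and there are finitely many $G_{(S)}$-orbits on the union of the $G$-orbits in $RW$ containing $v_1, \ldots, v_r$. 2. Define $\Omega_S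 : RW \to R^l$ by $$\Omega_S\Big(\sum_{w\in W}\gamma_w w\Big) = \Big(\sum_{w\in W_1}\gamma_w, \ldots, \sum_{w\in W_l}\gamma_w\Big),$$ and let $u_1, \ldots, u_t$ be any representatives (repetitions allowed) of the $G_{(S)}$-orbits on the union of the $G$-orbits in $RW$ containing $v_1, \ldots, v_r$. Then $$x \in \langle v_1, \ldots, v_r\rangle_{RG} \iff \Omega_S(x) \in \langle \Omega_S(u_1), \ldots, \Omega_S(u_t)\rangle_R .$$ -/

import Mathlib

open scoped FirstOrder

universe u v w

namespace RamseyModules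

/-! ### Automorphism groups and `ω`-categoricity -/

section Automorphisms

variable {L : FirstOrder.Language.{u, v}} {M : Type w} [L.Structure M]

/-- The automorphism group `Aut(M)` of a first-order structure, with composition as product. -/
instance autGroup : Group (M ≃[L] M) where
  mul g h := FirstOrder.Language.Equiv.comp g h
  one := FirstOrder.Language.Equiv.refl L M
  inv g := FirstOrder.Language.Equiv.symm g
  mul_assoc _ _ _ := rfl
  one_mul _ := rfl
  mul_one _ := rfl
  inv_mul_cancel g := by
    ext a
    exact g.symm_apply_apply a

theorem aut_mul_apply (g h : M ≃[L] M) (a : M) : (g * h) a = g (h a) := rfl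

theorem aut_one_apply (a : M) : (1 : M ≃[L] M) a = a := rfl

/-- Sets which are definable without parameters are invariant under automorphisms. -/
theorem definable_aut_iff {α : Type*} {s : Set (α → M)} (hs : (∅ : Set M).Definable L s)
    (g : M ≃[L] M) (a : α → M) : (g ∘ a) ∈ s ↔ a ∈ s := by
  obtain ⟨φ, rfl⟩ := Set.empty_definable_iff.1 hs
  exact FirstOrder.Language.StrongHomClass.realize_formula g φ

end Automorphisms

/-- `M` is `ω`-categorical: it is countably infinite, and its complete theory has exactly one
countably infinite model up to isomorphism. -/
structure IsOmegaCategorical (L : FirstOrder.Language.{u, v}) (M : Type w) [L.Structure M] : Prop where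
  countable : Countable M
  infinite : Infinite M
  categorical : Cardinal.Categorical (Cardinal.aleph0 : Cardinal.{w}) (L.completeTheory M)

/-! ### Ramsey structures -/

/-- The copies of `A` inside `C`: the substructures of `C` isomorphic to `A`. -/
def Copies {L : FirstOrder.Language.{u, v}} (A C : CategoryTheory.Bundled.{w} L.Structure) : Type w :=
  {A' : L.Substructure C // Nonempty (A' ≃[L] A)}

/-- A Ramsey class of rigid finite structures. -/
structure IsRigidRamseyClass {L : FirstOrder.Language.{u, v}}
    (K : Set (CategoryTheory.Bundled.{w} L.Structure)) : Prop where
  finite : ∀ A ∈ K, Finite A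
  rigid : ∀ A ∈ K, ∀ g : A ≃[L] A, g = FirstOrder.Language.Equiv.refl L A
  iso_closed : ∀ A B : CategoryTheory.Bundled.{w} L.Structure,
    A ∈ K → Nonempty (A ≃[L] B) → B ∈ K
  hereditary : FirstOrder.Language.Hereditary K
  /-- for all `A ⊆ B` in the class and all `k` there is `C ⊇ B` in the class such that every
  `k`-colouring of the copies of `A` in `C` is constant on the copies of `A` contained in some
  copy `B'` of `B` in `C` -/
  ramsey : ∀ A B : CategoryTheory.Bundled.{w} L.Structure, A ∈ K → B ∈ K →
    Nonempty (A ↪[L] B) → ∀ k : ℕ,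
      ∃ C : CategoryTheory.Bundled.{w} L.Structure, C ∈ K ∧ Nonempty (B ↪[L] C) ∧
        ∀ f : Copies A C → Fin k, ∃ B' : Copies B C,
          ∀ A₁ A₂ : Copies A C, A₁.1 ≤ B'.1 → A₂.1 ≤ B'.1 → f A₁ = f A₂

/-- A Ramsey structure: a countable Fraïssé (that is, ultrahomogeneous) structure whose age is a
Ramsey class of rigid finite structures. -/
structure IsRamseyStructure (L : FirstOrder.Language.{u, v}) (M : Type w) [L.Structure M] : Prop where
  countable : Countable M
  ultrahomogeneous : L.IsUltrahomogeneous M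
  age_ramsey : IsRigidRamseyClass (L.age M)

/-! ### Sorts of `M^eq` -/

/-- A sort `D / E` of `M^eq`: a `∅`-definable set `D` of `n`-tuples together with a `∅`-definable
equivalence relation `E` on `D`. -/
structure EqSort (L : FirstOrder.Language.{u, v}) (M : Type w) [L.Structure M] where
  n : ℕ
  D : Set (Fin n → M)
  definable_D : (∅ : Set M).Definable L D
  E : Setoid D
  definable_E : (∅ : Set M).Definable L
    {p : Fin n ⊕ Fin n → M | ∃ (ha : p ∘ Sum.inl ∈ D) (hb : p ∘ Sum.inr ∈ D),
      E ⟨p ∘ Sum.inl, ha⟩ ⟨p ∘ Sum.inr, hb⟩}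

namespace EqSort

variable {L : FirstOrder.Language.{u, v}} {M : Type w} [L.Structure M] (s : EqSort L M)

/-- The imaginary elements of the sort `D / E`, i.e. the `E`-classes. -/
def Elem : Type w := Quotient s.E

theorem E_aut (g : M ≃[L] M) {a b : s.D} (h : s.E a b) :
    s.E ⟨g ∘ a.1, (definable_aut_iff s.definable_D g a.1).2 a.2⟩
      ⟨g ∘ b.1, (definable_aut_iff s.definable_D g b.1).2 b.2⟩ := by
  have key := (definable_aut_iff s.definable_E g (Sum.elim a.1 b.1)).2 ⟨a.2, b.2, h⟩
  obtain ⟨_, _, h'⟩ := key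
  exact h'

/-- `Aut(M)` acts on `D / E` by acting coordinatewise on representatives. -/
instance : MulAction (M ≃[L] M) s.Elem where
  smul g := Quotient.map
    (fun a : s.D => ⟨g ∘ a.1, (definable_aut_iff s.definable_D g a.1).2 a.2⟩)
    (fun _ _ h => s.E_aut g h)
  one_smul x := by
    induction x using Quotient.inductionOn
    rfl
  mul_smul g h x := by
    induction x using Quotient.inductionOn
    rfl

end EqSort

/-! ### Permutation modules -/

section PermutationModules

variable (R : Type*) [CommRing R] (G : Type*) [Group G] (W : Type*) [MulAction G W]

/-- The permutation module `RW`: the free `R`-module `W →₀ R` with basis `W`, on which `G` acts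
`R`-linearly by permuting the basis. -/
noncomputable def permRep : Representation R G (W →₀ R) where
  toFun g := Finsupp.lmapDomain R R (fun a => g • a)
  map_one' := by
    ext
    simp
  map_mul' g h := by
    ext
    simp [mul_smul]

variable {R G W}

/-- `⟨v₁, …, v_r⟩_{RG}`: the `RG`-submodule of `RW` generated by `v₁, …, v_r`, where `RG` is the
group ring `MonoidAlgebra R G`. -/
noncomputable def generatedSubmodule {r : ℕ} (v : Fin r → (W →₀ R)) :
    Submodule (MonoidAlgebra R G) (permRep R G W).asModule :=
  Submodule.span (MonoidAlgebra R G)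
    (Set.range fun i => (permRep R G W).asModuleEquiv.symm (v i))

/-- The orbit of the vector `y ∈ RW` under a subgroup `H` of `G`. -/
def vectorOrbit (H : Subgroup G) (y : W →₀ R) : Set (W →₀ R) :=
  {z | ∃ h ∈ H, z = permRep R G W h y}

/-- The union of the `G`-orbits on `RW` containing `v₁, …, v_r`. -/
def orbitUnion (G : Type*) [Group G] [MulAction G W] {r : ℕ} (v : Fin r → (W →₀ R)) :
    Set (W →₀ R) :=
  ⋃ i, vectorOrbit (⊤ : Subgroup G) (v i)

/-- The set of `H`-orbits on the union of the `G`-orbits containing `v₁, …, v_r`. -/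
def orbitsOnUnion (H : Subgroup G) {r : ℕ} (v : Fin r → (W →₀ R)) : Set (Set (W →₀ R)) :=
  vectorOrbit H '' orbitUnion G v

/-- The list `u` represents the `H`-orbits on the union of the `G`-orbits containing
`v₁, …, v_r`: its entries lie in that union, and it meets every such `H`-orbit (an orbit may be
represented more than once). -/
structure IsOrbitReps (H : Subgroup G) {r t : ℕ} (v : Fin r → (W →₀ R))
    (u : Fin t → (W →₀ R)) : Prop where
  mem_union : ∀ j, u j ∈ orbitUnion G v
  meets : ∀ O ∈ orbitsOnUnion H v, ∃ j, u j ∈ O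

open Classical in
/-- The map `Ω : RW → R^l` for a subgroup `H` with orbits `W₁, …, W_l` on `W` (listed by `e`): the
`i`-th entry of `Ω z` is the sum of the coefficients of `z` over `W_i`. -/
noncomputable def Omega {H : Subgroup G} {l : ℕ} (e : Fin l ≃ MulAction.orbitRel.Quotient H W)
    (z : W →₀ R) : Fin l → R :=
  fun i => ∑ a ∈ z.support with a ∈ (e i).orbit, z a

end PermutationModules

end RamseyModules

/-!
For the first part, the Ryll-Nardzewski theorem and ultrahomogeneity show that `Aut(M)` is
oligomorphic on `M`. Suppose that there are infinitely many types in `n` variables. Then some type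
`p` is not isolated. Types in the variables `x₀, x₁, …` form a Baire space, and all of them are
realized in `M`, so there is a sequence in `M` whose range is an elementary substructure omitting
`p`. By `ω`-categoricity this substructure is isomorphic to `M`, but `M` realizes `p`
(`IsOmegaCategorical.finite_completeType`). Being oligomorphic passes to sorts of `M^eq` and to
pointwise stabilizers of finite sets, and an orbit of vectors is controlled by an orbit of tuples
enumerating their supports (`finite_orbitsOnUnion`).

For the second part, membership in the `RG`-submodule clearly gives the relation between the orbit
sums. For the converse, write `H` for the stabilizer of the support of `x`, and suppose that `x` has
the same orbit sums as a vector `y` of the submodule `N`, but `x ∉ N`. Choose an additive character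
`f` with values in the circle which vanishes on `N` but not at `x`. For all `g ∈ H` the value of `f`
at `g (x - y)` is `f x ≠ 0`, as `H` fixes `x` and preserves `N`. On the other hand `x - y` is a
finite sum of vectors `γ (h w - w)` with `h ∈ H`. Colour `w` by a finite approximation of the values
`f (γ w)`. The Ramsey property of `M`, read as a property of `Aut(M)`
(`IsRamseyStructure.isRamseyAction`) and transferred to `H` acting on the sort
(`IsRamseyAction.eqSort`, `IsRamseyAction.fixingSubgroup`), gives `g ∈ H` such that `g h w` and
`g w` have the same colour for all terms of the sum. Then `f (g (x - y))` is as small as desired, a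
contradiction (`mem_of_orbitSums_eq`).
-/

namespace RamseyModules

/-! ### The Ryll-Nardzewski theorem -/

section RyllNardzewski

open FirstOrder FirstOrder.Language Set

variable {L : FirstOrder.Language.{u, v}} {M : Type w} [L.Structure M]

theorem realize_congr_of_eqOn_freeVarFinset {α : Type*} [DecidableEq α] (φ : L.Formula α)
    {a b : α → M} (h : ∀ i ∈ φ.freeVarFinset, a i = b i) : φ.Realize a ↔ φ.Realize b := by
  rw [Formula.Realize, Formula.Realize,
    ← BoundedFormula.realize_restrictFreeVar (f := id) (v := fun i => a i) a (fun _ => rfl),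
    ← BoundedFormula.realize_restrictFreeVar (f := id) (v := fun i => a i) b
      (fun i => h i.1 i.2)]

theorem typeOf_eq_iff {α : Type*} {N N' : Type*} [L.Structure N] [L.Structure N']
    [Nonempty N] [Nonempty N'] (T : L.Theory) [N ⊨ T] [N' ⊨ T] (a : α → N) (b : α → N') :
    T.typeOf a = T.typeOf b ↔ ∀ φ : L.Formula α, φ.Realize a ↔ φ.Realize b := by
  rw [SetLike.ext_iff]
  refine ⟨fun h φ => ?_, fun h φ => ?_⟩
  · simpa using h (Formula.equivSentence φ)
  · rw [Theory.CompleteType.mem_typeOf, Theory.CompleteType.mem_typeOf]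
    exact h _

theorem infinite_of_model_completeTheory [Infinite M] {N : Type*} [L.Structure N]
    [N ⊨ L.completeTheory M] : Infinite N := by
  have : M ≅[L] N := elementarilyEquivalent_iff.2 fun φ => by
    refine ⟨fun h => Theory.realize_sentence_of_mem (L.completeTheory M) h, fun h => ?_⟩
    by_contra h'
    exact Theory.realize_sentence_of_mem (M := N) (L.completeTheory M) (φ := φ.not) h' h
  exact this.infinite_iff.1 inferInstance

/-- Any countable model of the theory of an `ω`-categorical structure `M`, in whatever universe it
lives, is isomorphic to `M`. -/
theorem IsOmegaCategorical.nonempty_equiv (hcat : IsOmegaCategorical L M)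
    {N : Type*} [L.Structure N] [Nonempty N] [N ⊨ L.completeTheory M]
    [Countable N] : Nonempty (N ≃[L] M) := by
  have := hcat.countable
  have := hcat.infinite
  have : Infinite N := infinite_of_model_completeTheory (L := L) (M := M)
  obtain ⟨e⟩ : Nonempty (N ≃ M) := nonempty_equiv_of_countable
  let N' : (L.completeTheory M).ModelType :=
    Theory.ModelType.equivInduced (M := Theory.ModelType.of _ N) e
  obtain ⟨f⟩ := hcat.categorical N' (Theory.ModelType.of _ M)
    (Cardinal.mk_eq_aleph0 M) (Cardinal.mk_eq_aleph0 M)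
  let e' : N ≃[L] N' := Equiv.inducedStructureEquiv e
  exact ⟨f.comp e'⟩

/-- An `ω`-categorical structure realizes every type over `∅` in countably many variables. -/
theorem IsOmegaCategorical.exists_typeOf_eq [Countable L.Symbols] [Nonempty M]
    (hcat : IsOmegaCategorical L M)
    {α : Type*} [Countable α] (p : (L.completeTheory M).CompleteType α) :
    ∃ a : α → M, (L.completeTheory M).typeOf a = p := by
  have := hcat.infinite
  obtain ⟨N, a, rfl⟩ := Theory.exists_modelType_is_realized_in _ p
  have : Infinite N := infinite_of_model_completeTheory (L := L) (M := M)
  obtain ⟨S, haS, hS⟩ := exists_elementarySubstructure_card_eq L (range a)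
    (Cardinal.aleph0.{0}) le_rfl
    (by simpa only [Cardinal.lift_uzero, Cardinal.lift_aleph0, Cardinal.le_aleph0_iff_set_countable,
      Cardinal.lift_le_aleph0] using countable_range a)
    (by simpa [Language.card] using Cardinal.mk_le_aleph0_iff.2 ‹Countable L.Symbols›)
    (by simp)
  have : Countable S := by
    rw [← Cardinal.mk_le_aleph0_iff]
    simpa using hS.le
  obtain ⟨f⟩ := hcat.nonempty_equiv (N := S)
  refine ⟨fun i => f ⟨a i, haS (mem_range_self i)⟩, ?_⟩
  rw [typeOf_eq_iff]
  intro φ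
  have h1 := StrongHomClass.realize_formula f φ (v := fun i => ⟨a i, haS (mem_range_self i)⟩)
  have h2 := S.subtype.map_formula φ (fun i => ⟨a i, haS (mem_range_self i)⟩)
  exact h1.trans h2.symm

/-- If `p` is not isolated, then every nonempty `∅`-definable set of sequences contains a sequence
whose subtuple at the indices `ι` does not realize `p`. -/
theorem exists_realize_typeOf_ne [Countable L.Symbols] [Nonempty M]
    (hcat : IsOmegaCategorical L M) {n : ℕ}
    {p : (L.completeTheory M).CompleteType (Fin n)} (hp : ¬ IsOpen {p}) (ι : Fin n → ℕ)
    (ψ : L.Formula ℕ) {a : ℕ → M} (ha : ψ.Realize a) :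
    ∃ b : ℕ → M, ψ.Realize b ∧ (L.completeTheory M).typeOf (b ∘ ι) ≠ p := by
  by_contra! hcon
  apply hp
  obtain ⟨N, hN⟩ : ∃ N : ℕ, (∀ i ∈ ψ.freeVarFinset, i ≤ N) ∧ ∀ j, ι j ≤ N := by
    obtain ⟨N₁, h₁⟩ := ψ.freeVarFinset.bddAbove
    obtain ⟨N₂, h₂⟩ := (finite_range ι).bddAbove
    exact ⟨max N₁ N₂, fun i hi => le_max_of_le_left (h₁ hi),
      fun j => le_max_of_le_right (h₂ (mem_range_self j))⟩
  -- only the first `N + 1` entries of a sequence matter, so `ψ` can be read as a formula in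
  -- finitely many variables and projected to the coordinates `ι`
  let f : ℕ → Fin (N + 1) := fun i => Fin.ofNat (N + 1) (min i N)
  have hf : ∀ i ≤ N, (f i : ℕ) = i := fun i hi => by
    simp [f, Fin.ofNat, hi, Nat.mod_eq_of_lt (Nat.lt_succ_of_le hi)]
  have hdef : (∅ : Set M).Definable L {c : Fin (N + 1) → M | ψ.Realize (c ∘ f)} :=
    empty_definable_iff.2 ⟨ψ.relabel f, by ext; simp⟩
  obtain ⟨θ, hθ⟩ := empty_definable_iff.1 (hdef.image_comp (f ∘ ι))
  have hθ' : ∀ c : Fin n → M, θ.Realize c ↔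
      ∃ d : Fin (N + 1) → M, ψ.Realize (d ∘ f) ∧ d ∘ (f ∘ ι) = c := fun c =>
    (Set.ext_iff.1 hθ c).symm
  have key : (L.completeTheory M).typesWith (Formula.equivSentence θ) = {p} := by
    ext q
    obtain ⟨c, rfl⟩ := hcat.exists_typeOf_eq q
    rw [Theory.CompleteType.mem_typesWith_iff, Theory.CompleteType.formula_mem_typeOf, hθ',
      mem_singleton_iff]
    constructor
    · rintro ⟨d, hd, rfl⟩
      exact hcon _ hd
    · intro hc
      have h0 : θ.Realize (a ∘ ι) := by
        refine (hθ' _).2 ⟨fun i => a i, ?_, ?_⟩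
        · refine (realize_congr_of_eqOn_freeVarFinset ψ fun i hi => ?_).1 ha
          simp [hf i (hN.1 i hi)]
        · ext j
          simp [hf (ι j) (hN.2 j)]
      exact (hθ' _).1 (((typeOf_eq_iff _ c (a ∘ ι)).1 (hc.trans (hcon a ha).symm) θ).2 h0)
  rw [← key]
  exact CompleteType.isOpen_typesWith _

theorem isOpen_setOf_imp_mem (φ : L.Formula ℕ) (ψ : ℕ → L.Formula ℕ) (T : L.Theory) :
    IsOpen {q : T.CompleteType ℕ | Formula.equivSentence φ ∈ q →
      ∃ m, Formula.equivSentence (ψ m) ∈ q} := by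
  have : {q : T.CompleteType ℕ | Formula.equivSentence φ ∈ q →
      ∃ m, Formula.equivSentence (ψ m) ∈ q} = (T.typesWith (Formula.equivSentence φ))ᶜ ∪
        ⋃ m, T.typesWith (Formula.equivSentence (ψ m)) := by
    ext q
    simp [imp_iff_not_or]
  rw [this]
  exact (CompleteType.isClosed_typesWith _).isOpen_compl.union
    (isOpen_iUnion fun m => CompleteType.isOpen_typesWith _)

theorem dense_of_forall_formula {T : L.Theory} {α : Type*} {U : Set (T.CompleteType α)}
    (h : ∀ (ψ : L.Formula α) (q : T.CompleteType α), Formula.equivSentence ψ ∈ q →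
      ∃ q' ∈ U, Formula.equivSentence ψ ∈ q') : Dense U := by
  rw [CompleteType.isTopologicalBasis_range_typesWith.dense_iff]
  rintro _ ⟨ψ, rfl⟩ ⟨q, hq⟩
  obtain ⟨q', hU, hq'⟩ := h (Formula.equivSentence.symm ψ) q (by simpa using hq)
  exact ⟨q', by simpa using hq', hU⟩

/-- The set of types omitting `p` at the indices `ι` is open and dense when `p` is not isolated. -/
theorem isOpen_dense_omitting [Countable L.Symbols] [Nonempty M]
    (hcat : IsOmegaCategorical L M) {n : ℕ}
    {p : (L.completeTheory M).CompleteType (Fin n)} (hp : ¬ IsOpen {p}) (ι : Fin n → ℕ) :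
    let U := {q : (L.completeTheory M).CompleteType ℕ |
      ∃ φ : L.Formula (Fin n), Formula.equivSentence φ ∉ p ∧
        Formula.equivSentence (φ.relabel ι) ∈ q}
    IsOpen U ∧ Dense U := by
  refine ⟨?_, dense_of_forall_formula fun ψ q hq => ?_⟩
  · simp only [ofPred_exists, ofPred_and]
    exact isOpen_iUnion fun φ => isOpen_const.inter (CompleteType.isOpen_typesWith _)
  · obtain ⟨a, rfl⟩ := hcat.exists_typeOf_eq q
    obtain ⟨b, hb, hbp⟩ := exists_realize_typeOf_ne hcat hp ι ψ
      (Theory.CompleteType.formula_mem_typeOf.1 hq)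
    refine ⟨_, ?_, Theory.CompleteType.formula_mem_typeOf.2 hb⟩
    obtain ⟨c, rfl⟩ := hcat.exists_typeOf_eq p
    rw [Ne, typeOf_eq_iff, not_forall] at hbp
    obtain ⟨φ, hφ⟩ := hbp
    by_cases h : φ.Realize c
    · exact ⟨φ.not, by simp_all, by simp_all⟩
    · exact ⟨φ, by simp_all, by simp_all⟩

/-- It is a dense open condition on a sequence of elements of `M` that the sequence contains a
solution of `φ(a, y)` if there is one in `M`. -/
theorem isOpen_dense_witness [Countable L.Symbols] [Nonempty M]
    (hcat : IsOmegaCategorical L M) (φ : L.Formula (ℕ ⊕ Fin 1)) :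
    let U := {q : (L.completeTheory M).CompleteType ℕ |
      Formula.equivSentence (φ.iExs (Fin 1)) ∈ q →
        ∃ m, Formula.equivSentence (φ.relabel (Sum.elim id fun _ => m)) ∈ q}
    IsOpen U ∧ Dense U := by
  classical
  refine ⟨isOpen_setOf_imp_mem _ _ _, dense_of_forall_formula fun ψ q hq => ?_⟩
  obtain ⟨a, rfl⟩ := hcat.exists_typeOf_eq q
  rw [Theory.CompleteType.formula_mem_typeOf] at hq
  by_cases h : ∃ y : Fin 1 → M, φ.Realize (Sum.elim a y)
  · obtain ⟨y, hy⟩ := h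
    -- overwrite an entry of `a` on which neither `ψ` nor `φ` depends
    obtain ⟨m, hm⟩ := Infinite.exists_notMem_finset
      (ψ.freeVarFinset ∪ φ.freeVarFinset.preimage Sum.inl Sum.inl_injective.injOn)
    simp only [Finset.mem_union, Finset.mem_preimage, not_or] at hm
    refine ⟨(L.completeTheory M).typeOf (Function.update a m (y 0)), fun _ => ⟨m, ?_⟩, ?_⟩
    · rw [Theory.CompleteType.formula_mem_typeOf, Formula.realize_relabel]
      refine (realize_congr_of_eqOn_freeVarFinset φ fun i hi => ?_).1 hy
      rcases i with i | i
      · have : i ≠ m := fun h => hm.2 (h ▸ hi)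
        simp [this]
      · simp [Subsingleton.elim i 0]
    · rw [Theory.CompleteType.formula_mem_typeOf]
      refine (realize_congr_of_eqOn_freeVarFinset ψ fun i hi => ?_).1 hq
      have : i ≠ m := fun h => hm.1 (h ▸ hi)
      simp [this]
  · refine ⟨_, fun h' => (h ?_).elim, Theory.CompleteType.formula_mem_typeOf.2 hq⟩
    rw [Theory.CompleteType.formula_mem_typeOf, Formula.realize_iExs] at h'
    exact h'

/-- One half of the Ryll-Nardzewski theorem. Otherwise some type `p` is not isolated, and a generic
sequence in `M` has a range which is an elementary substructure omitting `p`. -/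
theorem IsOmegaCategorical.finite_completeType [Countable L.Symbols] [Nonempty M]
    (hcat : IsOmegaCategorical L M) (n : ℕ) :
    Finite ((L.completeTheory M).CompleteType (Fin n)) := by
  have := hcat.countable
  by_cases hall : ∀ p : (L.completeTheory M).CompleteType (Fin n), IsOpen {p}
  · have := discreteTopology_iff_isOpen_singleton.2 hall
    exact finite_of_compact_of_discrete
  push Not at hall
  obtain ⟨p, hp⟩ := hall
  have hdense := fun ι => isOpen_dense_omitting hcat hp ι
  have hdense' := isOpen_dense_witness hcat
  have : Nonempty ((L.completeTheory M).CompleteType ℕ) :=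
    ⟨(L.completeTheory M).typeOf fun _ => Classical.arbitrary M⟩
  obtain ⟨q, hq⟩ := (dense_iInter_of_isOpen
    (f := Sum.elim (fun ι : Fin n → ℕ => _) (fun φ : L.Formula (ℕ ⊕ Fin 1) => _))
    (Sum.rec (fun ι => (hdense ι).1) (fun φ => (hdense' φ).1))
    (Sum.rec (fun ι => (hdense ι).2) (fun φ => (hdense' φ).2))).nonempty
  obtain ⟨a, rfl⟩ := hcat.exists_typeOf_eq q
  rw [mem_iInter] at hq
  have homit : ∀ ι : Fin n → ℕ, (L.completeTheory M).typeOf (a ∘ ι) ≠ p := by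
    rintro ι rfl
    obtain ⟨φ, h1, h2⟩ := hq (Sum.inl ι)
    simp_all
  have hmeets : L.MeetsDefinable (range a) := by
    rintro D ⟨y, hy⟩ hD
    obtain ⟨φ, hφ⟩ := definable_iff_exists_formula_sum.1 hD
    have hD' : ∀ z, z ∈ D ↔ φ.Realize (Sum.elim (↑) ![z]) := fun z => Set.ext_iff.1 hφ ![z]
    choose j hj using fun x : range a => x.2
    let φ' : L.Formula (ℕ ⊕ Fin 1) := φ.relabel (Sum.map j id)
    have hφ' : ∀ z : Fin 1 → M, φ'.Realize (Sum.elim a z) ↔ z 0 ∈ D := by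
      intro z
      rw [hD', Formula.realize_relabel]
      have : Sum.elim a z ∘ Sum.map j id = Sum.elim (↑) ![z 0] := by
        ext (i | i)
        · exact hj i
        · simp [Subsingleton.elim i 0]
      rw [this]
    have h : Formula.equivSentence (φ'.iExs (Fin 1)) ∈ (L.completeTheory M).typeOf a →
      ∃ m, Formula.equivSentence (φ'.relabel (Sum.elim id fun _ => m)) ∈
        (L.completeTheory M).typeOf a := hq (Sum.inr φ')
    simp only [Theory.CompleteType.formula_mem_typeOf,
      Formula.realize_iExs, Formula.realize_relabel] at h
    obtain ⟨m, hm⟩ := h ⟨![y], (hφ' _).2 hy⟩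
    refine ⟨a m, ?_, mem_range_self m⟩
    refine (hφ' fun _ => a m).1 ?_
    convert hm using 1
    ext (i | i) <;> rfl
  let S := hmeets.toElementarySubstructure
  have hS : ∀ x, x ∈ S ↔ x ∈ range a := fun x => Set.ext_iff.1 hmeets.closure_eq_self x
  have : Countable S := inferInstance
  obtain ⟨f⟩ := hcat.nonempty_equiv (N := S)
  obtain ⟨c, rfl⟩ := hcat.exists_typeOf_eq p
  choose ι hι using fun i => (hS (f.symm (c i))).1 (f.symm (c i)).2
  refine (homit ι ((typeOf_eq_iff _ _ _).2 fun φ => ?_)).elim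
  have h1 := StrongHomClass.realize_formula f.symm φ (v := c)
  have h2 := S.subtype.map_formula φ (f.symm ∘ c)
  have h3 : a ∘ ι = S.subtype ∘ f.symm ∘ c := funext hι
  rw [h3]
  exact h2.trans h1

end RyllNardzewski

/-! ### Oligomorphic actions -/

section Oligomorphic

open MulAction

/-- An action of `G` on `X` is oligomorphic if `G` has finitely many orbits on `n`-tuples of
elements of `X`, for every `n`. -/
def IsOligomorphic (G X : Type*) [Group G] [MulAction G X] : Prop :=
  ∀ n : ℕ, Finite (orbitRel.Quotient G (Fin n → X))

theorem finite_orbits_of_map {G Y κ : Type*} [Group G] [MulAction G Y] [Finite κ] (τ : Y → κ)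
    (h : ∀ a b, τ a = τ b → ∃ g : G, g • a = b) : Finite (orbitRel.Quotient G Y) := by
  refine Finite.of_injective (fun q : orbitRel.Quotient G Y => τ q.out) fun p q hpq => ?_
  obtain ⟨g, hg⟩ := h _ _ hpq.symm
  rw [← Quotient.out_eq p, ← Quotient.out_eq q]
  exact Quotient.sound ⟨g, hg⟩

theorem finite_range_of_map {A B κ : Type*} [Finite κ] (τ : A → κ) (F : A → B)
    (h : ∀ a b, τ a = τ b → F a = F b) : (Set.range F).Finite := by
  refine Finite.of_injective (fun y : Set.range F => τ y.2.choose) fun y z hyz => Subtype.ext ?_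
  rw [← y.2.choose_spec, ← z.2.choose_spec]
  exact h _ _ hyz

theorem exists_smul_eq_of_mk_eq {G Y : Type*} [Group G] [MulAction G Y] {a b : Y}
    (h : (Quotient.mk'' a : orbitRel.Quotient G Y) = Quotient.mk'' b) : ∃ g : G, g • a = b :=
  Quotient.exact h.symm

theorem IsOligomorphic.fixingSubgroup {G X : Type*} [Group G] [MulAction G X]
    (h : IsOligomorphic G X) {S : Set X} (hS : S.Finite) :
    IsOligomorphic (fixingSubgroup G S) X := by
  intro n
  obtain ⟨m, s, -, rfl⟩ := hS.fin_param
  have := h (m + n)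
  refine finite_orbits_of_map
    (fun a : Fin n → X => (Quotient.mk'' (Fin.append s a) : orbitRel.Quotient G _)) ?_
  intro a b hab
  obtain ⟨g, hg⟩ := exists_smul_eq_of_mk_eq hab
  have hs : ∀ i, g • s i = s i := fun i => by
    simpa using congrFun hg (Fin.castAdd n i)
  have ha : ∀ i, g • a i = b i := fun i => by
    simpa using congrFun hg (Fin.natAdd m i)
  exact ⟨⟨g, (mem_fixingSubgroup_iff G).2 (by rintro _ ⟨i, rfl⟩; exact hs i)⟩, funext ha⟩

theorem IsOligomorphic.finite_orbits {G X : Type*} [Group G] [MulAction G X]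
    (h : IsOligomorphic G X) : Finite (orbitRel.Quotient G X) := by
  have := h 1
  refine finite_orbits_of_map
    (fun a : X => (Quotient.mk'' (fun _ => a) : orbitRel.Quotient G (Fin 1 → X))) ?_
  intro a b hab
  obtain ⟨g, hg⟩ := exists_smul_eq_of_mk_eq hab
  exact ⟨g, congrFun hg 0⟩

end Oligomorphic

section PermutationModules

/-! ### Orbits of vectors -/

variable {R : Type*} [CommRing R] {G : Type*} [Group G] {W : Type*} [MulAction G W]

theorem permRep_apply (g : G) (y : W →₀ R) :
    permRep R G W g y = y.mapDomain (fun a => g • a) := rfl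

theorem permRep_single (g : G) (a : W) (c : R) :
    permRep R G W g (Finsupp.single a c) = Finsupp.single (g • a) c := by
  rw [permRep_apply, Finsupp.mapDomain_single]

theorem permRep_congr {g h : G} {y : W →₀ R} (hy : ∀ a ∈ y.support, g • a = h • a) :
    permRep R G W g y = permRep R G W h y :=
  Finsupp.mapDomain_congr hy

theorem permRep_mul_apply (g h : G) (y : W →₀ R) :
    permRep R G W (g * h) y = permRep R G W g (permRep R G W h y) := by
  rw [map_mul]; rfl

theorem vectorOrbit_permRep {H : Subgroup G} {h : G} (hh : h ∈ H) (y : W →₀ R) :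
    vectorOrbit H (permRep R G W h y) = vectorOrbit H y := by
  ext z
  constructor
  · rintro ⟨k, hk, rfl⟩
    exact ⟨k * h, H.mul_mem hk hh, (permRep_mul_apply _ _ _).symm⟩
  · rintro ⟨k, hk, rfl⟩
    exact ⟨k * h⁻¹, H.mul_mem hk (H.inv_mem hh), by
      rw [← permRep_mul_apply, inv_mul_cancel_right]⟩

/-- A translate of a vector is determined by the translate of an enumeration of its support, so
orbits of tuples control orbits of vectors. -/
theorem finite_orbitsOnUnion {H : Subgroup G} (hH : IsOligomorphic H W) {r : ℕ}
    (v : Fin r → (W →₀ R)) : (orbitsOnUnion H v).Finite := by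
  have : orbitsOnUnion H v =
      ⋃ i, Set.range fun g : G => vectorOrbit H (permRep R G W g (v i)) := by
    ext O
    simp only [orbitsOnUnion, orbitUnion, vectorOrbit, Set.mem_image, Set.mem_iUnion,
      Set.mem_range]
    constructor
    · rintro ⟨y, ⟨i, g, -, rfl⟩, rfl⟩
      exact ⟨i, g, rfl⟩
    · rintro ⟨i, g, rfl⟩
      exact ⟨_, ⟨i, g, Subgroup.mem_top g, rfl⟩, rfl⟩
  rw [this]
  refine Set.finite_iUnion fun i => ?_
  obtain ⟨m, s, -, hs⟩ := (v i).support.finite_toSet.fin_param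
  have := hH m
  let τ : G → MulAction.orbitRel.Quotient H (Fin m → W) := fun g => Quotient.mk'' fun j => g • s j
  refine finite_range_of_map τ _ fun g g' hg => ?_
  obtain ⟨h, hh⟩ := exists_smul_eq_of_mk_eq hg
  have : permRep R G W g' (v i) = permRep R G W h (permRep R G W g (v i)) := by
    rw [← permRep_mul_apply]
    refine permRep_congr fun a ha => ?_
    obtain ⟨j, rfl⟩ : a ∈ Set.range s := hs ▸ ha
    rw [mul_smul]
    exact (congrFun hh j).symm
  rw [this]
  exact (vectorOrbit_permRep h.2 _).symm

end PermutationModules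

section Automorphisms

/-! ### Orbits of the automorphism group -/

open FirstOrder FirstOrder.Language

variable {L : FirstOrder.Language.{u, v}} {M : Type w} [L.Structure M]

/-- The action of `Aut(M)` on `M`. -/
instance autMulAction : MulAction (M ≃[L] M) M where
  smul g a := g a
  one_smul _ := rfl
  mul_smul _ _ _ := rfl

/-- In an ultrahomogeneous structure, tuples satisfying the same formulas are conjugate. -/
theorem exists_aut_of_realize_iff (hom : L.IsUltrahomogeneous M) {α : Type*} [Finite α]
    {a b : α → M} (h : ∀ φ : L.Formula α, φ.Realize a ↔ φ.Realize b) :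
    ∃ g : M ≃[L] M, ∀ i, g (a i) = b i := by
  let S : L.Substructure M := Substructure.closure L (Set.range a)
  have hS : ∀ s : S, ∃ t : L.Term α, t.realize a = s := fun s => by
    obtain ⟨t, ht⟩ := Substructure.mem_closure_iff_exists_term.1 s.2
    refine ⟨t.relabel fun x => x.2.choose, ?_⟩
    rw [Term.realize_relabel, ← ht]
    congr
    ext x
    exact x.2.choose_spec
  choose t ht using hS
  have key : ∀ t₁ t₂ : L.Term α, t₁.realize a = t₂.realize a ↔ t₁.realize b = t₂.realize b :=
    fun t₁ t₂ => by simpa using h (t₁.equal t₂)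
  let f : S ↪[L] M :=
    { toFun := fun s => (t s).realize b
      inj' := fun s s' hs => Subtype.ext <| by
        rw [← ht s, ← ht s']
        exact (key _ _).2 hs
      map_fun' := fun {n} F x => by
        change _ = (Term.func F fun i => t (x i)).realize b
        refine (key _ _).1 ?_
        rw [ht, Term.realize_func]
        simp only [ht]
        rfl
      map_rel' := fun {n} r x => by
        have := h (r.formula fun i => t (x i))
        simp only [Formula.realize_rel, ht] at this
        exact this.symm }
  obtain ⟨g, hg⟩ := hom S (Substructure.fg_closure (Set.finite_range a)) f
  refine ⟨g, fun i => ?_⟩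
  have hi : a i ∈ S := Substructure.subset_closure (Set.mem_range_self i)
  have h1 : f ⟨a i, hi⟩ = g (a i) := by rw [hg]; rfl
  rw [← h1]
  exact (key (t ⟨a i, hi⟩) (Term.var i)).1 (ht _)

theorem IsOmegaCategorical.isOligomorphic [Countable L.Symbols]
    (hcat : IsOmegaCategorical L M) (hom : L.IsUltrahomogeneous M) :
    IsOligomorphic (M ≃[L] M) M := by
  intro n
  have := hcat.infinite
  have := hcat.finite_completeType n
  refine finite_orbits_of_map (L.completeTheory M).typeOf fun a b hab => ?_
  obtain ⟨g, hg⟩ := exists_aut_of_realize_iff hom ((typeOf_eq_iff _ a b).1 hab)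
  exact ⟨g, funext hg⟩

theorem EqSort.smul_mk (W : EqSort L M) (g : M ≃[L] M) (a : W.D) :
    g • (show W.Elem from Quotient.mk W.E a) =
      Quotient.mk W.E ⟨g ∘ a.1, (definable_aut_iff W.definable_D g a.1).2 a.2⟩ := rfl

/-- A tuple of elements of `M` representing an element of the sort. -/
noncomputable def EqSort.rep (W : EqSort L M) (w : W.Elem) : W.D := Quotient.out w

theorem EqSort.smul_eq_of_rep (W : EqSort L M) {g : M ≃[L] M} {w w' : W.Elem}
    (h : ∀ j, g ((W.rep w).1 j) = (W.rep w').1 j) : g • w = w' := by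
  have hw : (show W.Elem from Quotient.mk W.E (W.rep w)) = w := Quotient.out_eq w
  have hw' : (show W.Elem from Quotient.mk W.E (W.rep w')) = w' := Quotient.out_eq w'
  conv_lhs => rw [← hw]
  rw [← hw', EqSort.smul_mk]
  exact congrArg (Quotient.mk W.E) (Subtype.ext (funext h))

theorem IsOligomorphic.eqSort (h : IsOligomorphic (M ≃[L] M) M) (W : EqSort L M) :
    IsOligomorphic (M ≃[L] M) W.Elem := by
  intro k
  have := h (k * W.n)
  refine finite_orbits_of_map (fun w : Fin k → W.Elem =>
    (Quotient.mk'' fun p => (W.rep (w (finProdFinEquiv.symm p).1)).1 (finProdFinEquiv.symm p).2 :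
      MulAction.orbitRel.Quotient (M ≃[L] M) (Fin (k * W.n) → M))) ?_
  intro w w' hw
  obtain ⟨g, hg⟩ := exists_smul_eq_of_mk_eq hw
  refine ⟨g, funext fun i => W.smul_eq_of_rep fun j => ?_⟩
  have := congrFun hg (finProdFinEquiv (i, j))
  simp only [Pi.smul_apply, Equiv.symm_apply_apply] at this
  exact this

end Automorphisms

/-! ### The Ramsey property as a property of the automorphism group -/

section RamseyAction

/-- The Ramsey property of an action of `G` on `X`: if a finite colouring `F` of `G` only depends
on the restriction of `g` to a finite subset of `X`, then for every finite family `h` in `G` some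
translate `g` makes `F` constant on `g` and the products `g * h i`. For the closed group `G` of
permutations of a countable set `X`, this is the combinatorial form of extreme amenability. -/
def IsRamseyAction (G : Type*) (X : Type*) [Group G] [MulAction G X] : Prop :=
  ∀ (S : Set X), S.Finite → ∀ (m k : ℕ) (F : G → Fin m),
    (∀ g g' : G, (∀ a ∈ S, g • a = g' • a) → F g = F g') →
    ∀ h : Fin k → G, ∃ g : G, ∀ i, F (g * h i) = F g

theorem IsRamseyAction.exists_mul_eq {G X : Type*} [Group G] [MulAction G X]
    (hG : IsRamseyAction G X) {S : Set X} (hS : S.Finite) {κ ι : Type*} [Finite κ] [Finite ι]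
    (F : G → κ) (hF : ∀ g g' : G, (∀ a ∈ S, g • a = g' • a) → F g = F g') (h : ι → G) :
    ∃ g : G, ∀ i, F (g * h i) = F g := by
  obtain ⟨m, ⟨e⟩⟩ := Finite.exists_equiv_fin κ
  obtain ⟨k, ⟨e'⟩⟩ := Finite.exists_equiv_fin ι
  obtain ⟨g, hg⟩ := hG S hS m k (e ∘ F) (fun g g' h => congrArg e (hF g g' h)) (h ∘ e'.symm)
  exact ⟨g, fun i => by simpa using hg (e' i)⟩

/-- The Ramsey property passes to the pointwise stabilizer `H` of a finite set. A colouring of `H`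
extends to a colouring of `G` by first moving each left coset of `H` back to `H`, using a fixed
representative of the coset. -/
theorem IsRamseyAction.fixingSubgroup {G X : Type*} [Group G] [MulAction G X]
    (hG : IsRamseyAction G X) {S : Set X} (hS : S.Finite) :
    IsRamseyAction (fixingSubgroup G S) X := by
  intro T hT m k F hF h
  let H := _root_.fixingSubgroup G S
  let t : G → G := fun g => (QuotientGroup.mk g : G ⧸ H).out
  have ht : ∀ g, (t g)⁻¹ * g ∈ H := fun g =>
    QuotientGroup.eq.1 (QuotientGroup.out_eq' (QuotientGroup.mk g : G ⧸ H))
  have ht' : ∀ g g' : G, g⁻¹ * g' ∈ H → t g = t g' := fun g g' hg =>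
    congrArg Quotient.out (QuotientGroup.eq.2 hg)
  let η : G → H := fun g => ⟨(t g)⁻¹ * g, ht g⟩
  obtain ⟨g, hg⟩ := hG (S ∪ T) (hS.union hT) m k (F ∘ η) (fun g g' hgg => by
    have h1 : t g = t g' := ht' _ _ ((mem_fixingSubgroup_iff G).2 fun a ha => by
      rw [mul_smul, ← hgg a (Or.inl ha), inv_smul_smul])
    refine hF _ _ fun a ha => ?_
    change ((t g)⁻¹ * g) • a = ((t g')⁻¹ * g') • a
    rw [mul_smul, mul_smul, hgg a (Or.inr ha), h1]) (fun i => h i)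
  refine ⟨η g, fun i => ?_⟩
  rw [← show F (η (g * h i)) = F (η g) from hg i]
  congr 1
  refine Subtype.ext ?_
  change (t g)⁻¹ * g * h i = (t (g * h i))⁻¹ * (g * h i)
  rw [← ht' g (g * h i) (by rw [inv_mul_cancel_left]; exact (h i).2), mul_assoc]

/-- A finite colouring of `X` can be made constant on each of finitely many pairs `w i`, `h i • w i`
by a single translation. -/
theorem IsRamseyAction.exists_smul_eq {G X : Type*} [Group G] [MulAction G X]
    (hG : IsRamseyAction G X) {κ ι : Type*} [Finite κ] [Finite ι] (χ : X → κ) (w : ι → X)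
    (h : ι → G) : ∃ g : G, ∀ i, χ (g • h i • w i) = χ (g • w i) := by
  obtain ⟨g, hg⟩ := hG.exists_mul_eq (Set.finite_range w) (fun g i => χ (g • w i))
    (fun g g' hgg => funext fun i => by rw [hgg _ (Set.mem_range_self i)]) h
  exact ⟨g, fun i => by simpa [mul_smul] using congrFun (hg i) i⟩

end RamseyAction

section Automorphisms

open FirstOrder FirstOrder.Language CategoryTheory

variable {L : FirstOrder.Language.{u, v}} {M : Type w} [L.Structure M]

/-- A colouring of `Aut(M)` that depends on the restriction of an automorphism to a finitely
generated substructure `A` is, by ultrahomogeneity and rigidity, a colouring of the copies of `A`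
in `M`. -/
theorem IsRamseyStructure.isRamseyAction (hram : IsRamseyStructure L M) :
    IsRamseyAction (M ≃[L] M) M := by
  intro S hS m k F hF h
  let A : L.Substructure M := Substructure.closure L S
  let B : L.Substructure M := Substructure.closure L (S ∪ ⋃ i, h i '' S)
  have hAfg : A.FG := Substructure.fg_closure hS
  have hBfg : B.FG := Substructure.fg_closure (hS.union (Set.finite_iUnion fun i => hS.image _))
  have hAB : A ≤ B := Substructure.closure_mono Set.subset_union_left
  have hB : ∀ i, ∀ a : A, h i a ∈ B := fun i a => by
    have : A ≤ B.comap (h i).toHom := Substructure.closure_le.2 fun a ha =>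
      Substructure.subset_closure (Or.inr (Set.mem_iUnion.2 ⟨i, a, ha, rfl⟩))
    exact this a.2
  have hA' := age.fg_substructure hAfg
  obtain ⟨C, hC, -, hCR⟩ := hram.age_ramsey.ramsey (Bundled.mk A) (Bundled.mk B)
    hA' (age.fg_substructure hBfg) ⟨Substructure.inclusion hAB⟩ m
  obtain ⟨-, ⟨e⟩⟩ := hC
  have hext : ∀ A₁ : Copies (Bundled.mk A) C, ∃ g : M ≃[L] M, ∃ φ : A₁.1 ≃[L] A,
      ∀ a : A, g a = e (φ.symm a) := fun A₁ => by
    obtain ⟨φ⟩ := A₁.2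
    obtain ⟨g, hg⟩ := hram.ultrahomogeneous A hAfg
      (e.comp (A₁.1.subtype.comp φ.symm.toEmbedding))
    exact ⟨g, φ, fun a => (DFunLike.congr_fun hg a).symm⟩
  choose γ φ hγ using hext
  obtain ⟨B', hB'⟩ := hCR fun A₁ => F (γ A₁)
  obtain ⟨ψ⟩ := B'.2
  obtain ⟨g, hg⟩ := hram.ultrahomogeneous B hBfg
    (e.comp (B'.1.subtype.comp ψ.symm.toEmbedding))
  have hg' : ∀ b : B, e (ψ.symm b : B'.1) = g b := fun b => DFunLike.congr_fun hg b
  -- the colour of `g * j` is the colour of the copy `g (j A)` of `A`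
  have key : ∀ j : M ≃[L] M, (∀ a : A, j a ∈ B) →
      ∃ A₁ : Copies (Bundled.mk A) C, A₁.1 ≤ B'.1 ∧ F (γ A₁) = F (g * j) := fun j hj => by
    let σ : A ↪[L] B := Embedding.codRestrict B (j.toEmbedding.comp A.subtype) hj
    let τ : A ↪[L] C := B'.1.subtype.comp (ψ.symm.toEmbedding.comp σ)
    let A₁ : Copies (Bundled.mk A) C := ⟨τ.toHom.range, ⟨τ.equivRange.symm⟩⟩
    refine ⟨A₁, ?_, hF _ _ fun a ha => ?_⟩
    · rintro _ ⟨a, rfl⟩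
      exact (ψ.symm (σ a) : B'.1).2
    · let a' : A := ⟨a, Substructure.subset_closure ha⟩
      have hrigid := hram.age_ramsey.rigid _ hA' ((φ A₁).comp τ.equivRange)
      have h1 : φ A₁ (τ.equivRange a') = a' := DFunLike.congr_fun hrigid a'
      have h2 : (φ A₁).symm a' = τ.equivRange a' := by
        conv_lhs => rw [← h1]
        exact (φ A₁).symm_apply_apply _
      change γ A₁ a' = g (j a)
      rw [hγ, h2]
      exact hg' (σ a')
  obtain ⟨A₀, hA₀, hA₀'⟩ := key 1 fun a => hAB a.2
  refine ⟨g, fun i => ?_⟩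
  obtain ⟨A₁, hA₁, hA₁'⟩ := key (h i) (hB i)
  rw [← hA₁', hB' A₁ A₀ hA₁ hA₀, hA₀', mul_one]

theorem IsRamseyAction.eqSort (hM : IsRamseyAction (M ≃[L] M) M) (W : EqSort L M) :
    IsRamseyAction (M ≃[L] M) W.Elem := by
  intro S hS m k F hF h
  refine hM (⋃ x ∈ S, Set.range (W.rep x).1) (hS.biUnion fun x _ => Set.finite_range _) m k F
    (fun g g' hgg => hF g g' fun x hx => ?_) h
  rw [← inv_smul_eq_iff, ← mul_smul]
  refine W.smul_eq_of_rep fun j => ?_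
  have := hgg ((W.rep x).1 j) (Set.mem_biUnion hx (Set.mem_range_self j))
  change (g'⁻¹ * g) • (W.rep x).1 j = _
  rw [mul_smul, this, inv_smul_smul]

end Automorphisms

/-! ### Additive characters with values in the circle -/

/-- Characters with values in `ℝ/ℤ` separate the elements of an abelian group from a subgroup. The
target is `ℝ/ℤ` rather than the injective cogenerator `ℚ/ℤ` since its compactness is needed. -/
theorem exists_addCircle_hom_ne_zero {A : Type*} [AddCommGroup A] (N : AddSubgroup A) {x : A}
    (hx : x ∉ N) : ∃ f : A →+ AddCircle (1 : ℝ), (∀ y ∈ N, f y = 0) ∧ f x ≠ 0 := by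
  have hx' : (QuotientAddGroup.mk x : A ⧸ N) ≠ 0 := by
    rwa [Ne, QuotientAddGroup.eq_zero_iff]
  obtain ⟨c, hc⟩ := CharacterModule.exists_character_apply_ne_zero_of_ne_zero hx'
  let ι : AddCircle (1 : ℚ) →+ AddCircle (1 : ℝ) :=
    QuotientAddGroup.map _ _ (Rat.castHom ℝ).toAddMonoidHom (by
      rintro _ ⟨n, rfl⟩
      exact ⟨n, by simp⟩)
  have hι : ∀ q, ι q = 0 → q = 0 := by
    intro q hq
    induction q using QuotientAddGroup.induction_on with
    | H q =>
      obtain ⟨n, hn⟩ := (QuotientAddGroup.eq_zero_iff _).1 hq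
      refine (QuotientAddGroup.eq_zero_iff _).2 ⟨n, ?_⟩
      have hn' : (n : ℝ) = (q : ℝ) := by simpa using hn
      simpa using mod_cast hn'
  refine ⟨ι.comp ((c : (A ⧸ N) →+ _).comp (QuotientAddGroup.mk' N)), fun y hy => ?_,
    fun h => hc (hι _ h)⟩
  change ι (c (QuotientAddGroup.mk y : A ⧸ N)) = 0
  rw [(QuotientAddGroup.eq_zero_iff y).2 hy, map_zero, map_zero]

/-- A compact metric space has a finite colouring with monochromatic sets of small diameter. -/
theorem exists_finite_colouring_dist_lt (X : Type u) [PseudoMetricSpace X] [CompactSpace X] {ε : ℝ}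
    (hε : 0 < ε) :
    ∃ (κ : Type u) (_ : Finite κ) (χ : X → κ), ∀ a b, χ a = χ b → dist a b < ε := by
  obtain ⟨t, -, ht, hcov⟩ :=
    finite_cover_balls_of_compact (isCompact_univ (X := X)) (half_pos hε)
  have : ∀ a : X, ∃ c : t, dist a c < ε / 2 := fun a => by
    obtain ⟨c, hc, hac⟩ := Set.mem_iUnion₂.1 (hcov (Set.mem_univ a))
    exact ⟨⟨c, hc⟩, hac⟩
  choose χ hχ using this
  refine ⟨t, ht, χ, fun a b hab => ?_⟩
  have h1 := hχ a
  have h2 := hχ b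
  rw [← hab] at h2
  linarith [dist_triangle_right a b (χ a)]

section PermutationModules

variable {R : Type*} [CommRing R] {G : Type*} [Group G] {W : Type*} [MulAction G W]

/-! ### The submodule generated by the vectors -/

theorem permRep_mem_span_orbitUnion {r : ℕ} (v : Fin r → (W →₀ R)) (g : G) {y : W →₀ R}
    (hy : y ∈ Submodule.span R (orbitUnion G v)) :
    permRep R G W g y ∈ Submodule.span R (orbitUnion G v) := by
  have : Submodule.span R (orbitUnion G v) ≤
      (Submodule.span R (orbitUnion G v)).comap (permRep R G W g) := by
    rw [Submodule.span_le]
    intro z hz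
    obtain ⟨i, k, -, rfl⟩ := Set.mem_iUnion.1 hz
    exact Submodule.subset_span (Set.mem_iUnion.2
      ⟨i, g * k, Subgroup.mem_top _, (permRep_mul_apply _ _ _).symm⟩)
  exact this hy

theorem mem_generatedSubmodule_iff {r : ℕ} (v : Fin r → (W →₀ R)) (y : W →₀ R) :
    (permRep R G W).asModuleEquiv.symm y ∈ generatedSubmodule (G := G) v ↔
      y ∈ Submodule.span R (orbitUnion G v) := by
  let E := (permRep R G W).asModuleEquiv
  constructor
  · intro hy
    have : ∀ z ∈ generatedSubmodule (G := G) v, E z ∈ Submodule.span R (orbitUnion G v) := by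
      intro z hz
      induction hz using Submodule.span_induction with
      | mem z hz =>
        obtain ⟨i, rfl⟩ := hz
        refine Submodule.subset_span (Set.mem_iUnion.2 ⟨i, 1, Subgroup.mem_top _, ?_⟩)
        simp [E]
      | zero => simp
      | add z z' _ _ h h' => rw [map_add]; exact add_mem h h'
      | smul a z _ h =>
        rw [Representation.asModuleEquiv_map_smul]
        induction a using MonoidAlgebra.induction_on with
        | of g =>
          rw [Representation.asAlgebraHom_of]
          exact permRep_mem_span_orbitUnion v _ h
        | add a b ha hb =>
          rw [map_add]
          exact add_mem ha hb
        | smul c a ha =>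
          rw [map_smul]
          exact Submodule.smul_mem _ _ ha
    simpa [E] using this _ hy
  · intro hy
    induction hy using Submodule.span_induction with
    | mem y hy =>
      obtain ⟨i, g, -, rfl⟩ := Set.mem_iUnion.1 hy
      rw [Representation.asModuleEquiv_symm_map_rho]
      exact Submodule.smul_mem _ _ (Submodule.subset_span ⟨i, rfl⟩)
    | zero => rw [map_zero]; exact zero_mem _
    | add y z _ _ h h' => rw [map_add]; exact add_mem h h'
    | smul c y _ h =>
      rw [Representation.asModuleEquiv_symm_map_smul]
      exact Submodule.smul_mem _ _ h

/-! ### Sums of coefficients over orbits -/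

/-- The sums of the coefficients of a vector over the orbits of `H`, as the pushforward of the
vector to the set of orbits. -/
noncomputable def orbitSums (H : Subgroup G) :
    (W →₀ R) →ₗ[R] (MulAction.orbitRel.Quotient H W →₀ R) :=
  Finsupp.lmapDomain R R Quotient.mk''

theorem orbitSums_permRep {H : Subgroup G} {h : G} (hh : h ∈ H) (y : W →₀ R) :
    orbitSums H (permRep R G W h y) = orbitSums H y := by
  change Finsupp.mapDomain _ (Finsupp.mapDomain _ y) = Finsupp.mapDomain _ y
  rw [← Finsupp.mapDomain_comp]
  congr 1
  ext a
  exact Quotient.sound ⟨⟨h, hh⟩, rfl⟩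

/-- `Omega e` is `orbitSums` read in the enumeration `e` of the orbits. -/
noncomputable def omegaEquiv {H : Subgroup G} {l : ℕ}
    (e : Fin l ≃ MulAction.orbitRel.Quotient H W) :
    (MulAction.orbitRel.Quotient H W →₀ R) ≃ₗ[R] (Fin l → R) :=
  (Finsupp.domLCongr e.symm).trans (Finsupp.linearEquivFunOnFinite R R (Fin l))

theorem omega_eq {H : Subgroup G} {l : ℕ} (e : Fin l ≃ MulAction.orbitRel.Quotient H W)
    (z : W →₀ R) : Omega e z = omegaEquiv e (orbitSums H z) := by
  classical
  ext i
  have : omegaEquiv e (orbitSums H z) i = Finsupp.mapDomain Quotient.mk'' z (e i) := by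
    rfl
  rw [this, Finsupp.mapDomain, Finsupp.sum_apply, Finsupp.sum, Omega, Finset.sum_filter]
  refine Finset.sum_congr rfl fun a _ => ?_
  rw [Finsupp.single_apply]
  simp only [MulAction.orbitRel.Quotient.mem_orbit]

/-- A vector with zero orbit sums is a sum of vectors `γ (h w - w)` with `h ∈ H`. -/
theorem exists_eq_sum_single_sub_single {H : Subgroup G} {z : W →₀ R} (hz : orbitSums H z = 0) :
    ∃ (w : z.support → W) (h : z.support → H),
      z = ∑ i, (Finsupp.single (h i • w i) (z i) - Finsupp.single (w i) (z i)) := by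
  let π : W → MulAction.orbitRel.Quotient H W := Quotient.mk''
  have hex : ∀ a : W, ∃ h : H, h • (π a).out = a := fun a =>
    exists_smul_eq_of_mk_eq (Quotient.out_eq (π a))
  choose h hh using hex
  refine ⟨fun i => (π i).out, fun i => h i, ?_⟩
  have h0 : Finsupp.mapDomain (fun a => (π a).out) z = 0 := by
    change Finsupp.mapDomain (Quotient.out ∘ π) z = 0
    rw [Finsupp.mapDomain_comp]
    have : Finsupp.mapDomain π z = 0 := hz
    rw [this, Finsupp.mapDomain_zero]
  simp_rw [hh]
  rw [Finset.sum_sub_distrib,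
    Finset.sum_coe_sort z.support (fun a => Finsupp.single a (z a)),
    Finset.sum_coe_sort z.support (fun a => Finsupp.single (π a).out (z a))]
  change z = z.sum Finsupp.single - Finsupp.mapDomain (fun a => (π a).out) z
  rw [h0, Finsupp.sum_single, sub_zero]

/-- If the action of `H` on `W` is Ramsey, then a vector with zero orbit sums has `H`-translates at
which a given character is as small as desired. -/
theorem exists_norm_apply_permRep_lt {H : Subgroup G} (hH : IsRamseyAction H W) {z : W →₀ R}
    (hz : orbitSums H z = 0) (f : (W →₀ R) →+ AddCircle (1 : ℝ)) {ε : ℝ} (hε : 0 < ε) :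
    ∃ g ∈ H, ‖f (permRep R G W g z)‖ < ε := by
  have : Fact ((0 : ℝ) < 1) := ⟨one_pos⟩
  obtain ⟨w, h, hzw⟩ := exists_eq_sum_single_sub_single hz
  have hpos : (0 : ℝ) < z.support.card + 1 := Nat.cast_add_one_pos _
  obtain ⟨κ, _, χ, hχ⟩ := exists_finite_colouring_dist_lt (AddCircle (1 : ℝ))
    (ε := ε / (z.support.card + 1)) (div_pos hε hpos)
  obtain ⟨g, hg⟩ := hH.exists_smul_eq
    (fun a (i : z.support) => χ (f (Finsupp.single a (z (i : W))))) w h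
  refine ⟨g, g.2, ?_⟩
  have hfz : f (permRep R G W g z) = ∑ i : z.support,
      (f (Finsupp.single (g • h i • w i) (z i)) - f (Finsupp.single (g • w i) (z i))) := by
    conv_lhs => rw [hzw]
    simp only [map_sum, map_sub, permRep_single]
    rfl
  rw [hfz]
  calc _ ≤ ∑ i : z.support, ε / (z.support.card + 1) := norm_sum_le_of_le _ fun i _ => by
          rw [← dist_eq_norm]
          exact (hχ _ _ (congrFun (hg i) i)).le
    _ = z.support.card * (ε / (z.support.card + 1)) := by simp
    _ < ε := by
      rw [← mul_div_assoc, div_lt_iff₀ hpos]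
      linarith

/-- If the action of `H` on `W` is Ramsey, then membership of an `H`-fixed vector `x` in a
`G`-invariant submodule only depends on the orbit sums of `x`. Otherwise a character `f` vanishes on
the submodule but not at `x`. If `y` in the submodule has the same orbit sums as `x`, then `f` takes
the value `f x` at all `H`-translates of `x - y`, so it is not small at any of them. -/
theorem mem_of_orbitSums_eq {H : Subgroup G} (hH : IsRamseyAction H W)
    (N : Submodule R (W →₀ R)) (hN : ∀ g : G, ∀ y ∈ N, permRep R G W g y ∈ N)
    {x y : W →₀ R} (hx : ∀ h ∈ H, permRep R G W h x = x) (hy : y ∈ N)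
    (hxy : orbitSums H x = orbitSums H y) : x ∈ N := by
  by_contra hxN
  obtain ⟨f, hf, hfx⟩ := exists_addCircle_hom_ne_zero N.toAddSubgroup hxN
  obtain ⟨g, hg, hlt⟩ := exists_norm_apply_permRep_lt hH (z := x - y)
    (by rw [map_sub, hxy, sub_self]) f (norm_pos_iff.2 hfx)
  rw [map_sub, map_sub, hx g hg, hf _ (hN g y hy), sub_zero] at hlt
  exact lt_irrefl _ hlt

theorem orbitSums_mem_span_of_mem {H : Subgroup G} {r t : ℕ} {v : Fin r → (W →₀ R)}
    {u : Fin t → (W →₀ R)} (hu : IsOrbitReps H v u) {x : W →₀ R}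
    (hx : x ∈ Submodule.span R (orbitUnion G v)) :
    orbitSums H x ∈ Submodule.span R (Set.range fun j => orbitSums H (u j)) := by
  have : Submodule.span R (orbitUnion G v) ≤
      (Submodule.span R (Set.range fun j => orbitSums H (u j))).comap (orbitSums H) := by
    rw [Submodule.span_le]
    intro y hy
    obtain ⟨j, h, hh, hj⟩ := hu.meets _ ⟨y, hy, rfl⟩
    refine Submodule.subset_span ⟨j, ?_⟩
    change orbitSums H (u j) = _
    rw [hj, orbitSums_permRep hh]
  exact this hx

theorem mem_generatedSubmodule_iff_omega_mem {H : Subgroup G} (hH : IsRamseyAction H W)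
    {r t l : ℕ} {v : Fin r → (W →₀ R)} {u : Fin t → (W →₀ R)} (hu : IsOrbitReps H v u)
    (e : Fin l ≃ MulAction.orbitRel.Quotient H W) {x : W →₀ R}
    (hx : ∀ h ∈ H, permRep R G W h x = x) :
    (permRep R G W).asModuleEquiv.symm x ∈ generatedSubmodule (G := G) v ↔
      Omega e x ∈ Submodule.span R (Set.range fun j => Omega e (u j)) := by
  have homega : Omega e x ∈ Submodule.span R (Set.range fun j => Omega e (u j)) ↔
      orbitSums H x ∈ Submodule.span R (Set.range fun j => orbitSums H (u j)) := by
    have : (Set.range fun j => Omega e (u j)) =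
        (omegaEquiv e).toLinearMap '' Set.range fun j => orbitSums H (u j) := by
      rw [← Set.range_comp]
      exact congrArg Set.range (funext fun j => omega_eq e (u j))
    rw [this, Submodule.span_image, omega_eq]
    exact (omegaEquiv e).injective.mem_set_image
  rw [mem_generatedSubmodule_iff, homega]
  refine ⟨orbitSums_mem_span_of_mem hu, fun h => ?_⟩
  rw [show (fun j => orbitSums H (u j)) = orbitSums H ∘ u from rfl, Set.range_comp,
    Submodule.span_image] at h
  obtain ⟨y, hy, hxy⟩ := h
  refine mem_of_orbitSums_eq hH _ (fun g y => permRep_mem_span_orbitUnion v g) hx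
    (Submodule.span_mono ?_ hy) hxy.symm
  rintro _ ⟨j, rfl⟩
  exact hu.mem_union j

end PermutationModules

end RamseyModules

theorem theorem1p3 {L : FirstOrder.Language.{u, v}} [Countable L.Symbols]
    {M : Type w} [L.Structure M]
    (hcat : RamseyModules.IsOmegaCategorical L M)
    (hram : RamseyModules.IsRamseyStructure L M)
    (W : RamseyModules.EqSort L M)
    {R : Type*} [CommRing R] {r : ℕ}
    (x : W.Elem →₀ R) (v : Fin r → (W.Elem →₀ R))
    (GS : Subgroup (M ≃[L] M))
    (hGS : GS = fixingSubgroup (M ≃[L] M) (x.support : Set W.Elem)) :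
    Finite (MulAction.orbitRel.Quotient GS W.Elem) ∧
    (RamseyModules.orbitsOnUnion GS v).Finite ∧
    ∀ (l : ℕ) (e : Fin l ≃ MulAction.orbitRel.Quotient GS W.Elem)
      (t : ℕ) (u : Fin t → (W.Elem →₀ R)), RamseyModules.IsOrbitReps GS v u →
      ((RamseyModules.permRep R (M ≃[L] M) W.Elem).asModuleEquiv.symm x ∈
          RamseyModules.generatedSubmodule (G := M ≃[L] M) v ↔
        RamseyModules.Omega e x ∈
          Submodule.span R (Set.range fun j => RamseyModules.Omega e (u j))) := by
  subst hGS
  have holig := ((hcat.isOligomorphic hram.ultrahomogeneous).eqSort W).fixingSubgroup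
    x.support.finite_toSet
  have hramsey := (hram.isRamseyAction.eqSort W).fixingSubgroup x.support.finite_toSet
  refine ⟨holig.finite_orbits, RamseyModules.finite_orbitsOnUnion holig v,
    fun l e t u hu => RamseyModules.mem_generatedSubmodule_iff_omega_mem hramsey hu e
      fun h hh => ?_⟩
  have : RamseyModules.permRep R (M ≃[L] M) W.Elem h x =
      RamseyModules.permRep R (M ≃[L] M) W.Elem 1 x :=
    RamseyModules.permRep_congr fun a ha => by
      rw [one_smul]
      exact (mem_fixingSubgroup_iff _).1 hh a ha
  rw [this, map_one]
  rfl
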